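/- Let $n,t,k$ be natural numbers with $n>2t$ and $k>\frac{n-t}{n-2t}$, and let $V$ be a finite set of at least $k+1$ values. Consider an asynchronous message-passing system of $n$ processes connected pairwise by point-to-point channels, where at most $t$ processes may crash. Executions are infinite sequences of atomic steps; in a step a single process may receive one message that is in transit to it, changes its local state, and sends finitely many messages. A process is correct in an execution if it takes infinitely many steps and crashes otherwise. Every message sent by a correct process to a correct process is eventually received, but there is no bound on delays or on relative speeds, and messages may be reordered. Then there is a deterministic algorithm (with computable local transitions and decisions) that solves $k$-set agreement in this system: for every assignment of initial values in $V$ to the processes, in every execution with at most $t$ crashed processes, each process decides at most one value, a value in $V$, and never revokes it, and - Validity: if all the correct processes propose the same initial value $v$, then no correct process decides a value different from $v$; - Agreement: at most $k$ different values are decided by the correct processes; - Termination: every correct process eventually decides. -/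

import Mathlib

/-- A deterministic algorithm for `n` processes, communicating by point-to-point messages, with
inputs and decisions in `V`.

* `init i v` is the initial local state of process `i` when it proposes `v`.
* `step i s r` is an atomic step of process `i` in local state `s`, in which it receives either
  nothing (`r = none`) or a message `m` from process `p` (`r = some (p, m)`). The result is the
  new local state and the list of messages sent, each one with its destination.
* `decision i s` is the value that process `i` has decided on in local state `s`, if any.

Transitions and decisions are required to be computable. (The set `V` is finite in the problem
below, so that there is nothing to ask of `init`, and that testing each value separately is the
same as computing the decision.) -/
structure MPAlgorithm (n : ℕ) (V : Type*) where
  State : Type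
  Msg : Type
  [primcodableState : Primcodable State]
  [primcodableMsg : Primcodable Msg]
  init : Fin n → V → State
  step : Fin n → State → Option (Fin n × Msg) → State × List (Fin n × Msg)
  decision : Fin n → State → Option V
  step_computable : ∀ i, Computable₂ (step i)
  decision_computable : ∀ i v, ComputablePred (fun s => decision i s = some v)

namespace MPAlgorithm

variable {n : ℕ} {V : Type*}

/-- A global configuration: the local states and the messages in transit, where `(p, q, m)` stands
for the message `m` sent by `p` to `q`. -/
structure Config (A : MPAlgorithm n V) where
  state : Fin n → A.State
  inTransit : Multiset (Fin n × Fin n × A.Msg)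

/-- The initial configuration for the vector `input` of proposed values. -/
def initial (A : MPAlgorithm n V) (input : Fin n → V) : A.Config where
  state := fun i => A.init i (input i)
  inTransit := 0

/-- The messages that leave the network when process `i` receives `r`. -/
def consumed (A : MPAlgorithm n V) (i : Fin n) :
    Option (Fin n × A.Msg) → Multiset (Fin n × Fin n × A.Msg)
  | none => 0
  | some (p, m) => {(p, i, m)}

/-- `A.Step c i r c'`: in configuration `c`, process `i` takes a step of the algorithm in which it
receives `r`, which has to be in transit to `i` unless it is `none`; this leads to `c'`. -/
def Step (A : MPAlgorithm n V) (c : A.Config) (i : Fin n) (r : Option (Fin n × A.Msg))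
    (c' : A.Config) : Prop :=
  ∃ rest : Multiset (Fin n × Fin n × A.Msg),
    c.inTransit = A.consumed i r + rest ∧
    c'.state = Function.update c.state i (A.step i (c.state i) r).1 ∧
    c'.inTransit =
      rest + (((A.step i (c.state i) r).2.map (fun e => (i, e.1, e.2)) : List _) : Multiset _)

/-- An infinite sequence of steps of the algorithm, from the initial configuration for `input`.
At time `τ`, process `proc τ` takes a step in which it receives `recv τ`. -/
structure Execution (A : MPAlgorithm n V) (input : Fin n → V) where
  config : ℕ → A.Config
  proc : ℕ → Fin n
  recv : ℕ → Option (Fin n × A.Msg)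
  config_zero : config 0 = A.initial input
  config_succ : ∀ τ, A.Step (config τ) (proc τ) (recv τ) (config (τ + 1))

namespace Execution

variable {A : MPAlgorithm n V} {input : Fin n → V}

/-- A process is correct if it takes infinitely many steps; otherwise it has crashed. -/
def Correct (E : A.Execution input) (i : Fin n) : Prop :=
  ∀ τ, ∃ τ' ≥ τ, E.proc τ' = i

/-- No communication failure: a message in transit between correct processes is eventually
received. Messages can be arbitrarily delayed and reordered, and nothing is promised about the
messages sent by a process that crashes (which also covers a crash in the midst of a step that
sends several messages). -/
def Reliable (E : A.Execution input) : Prop :=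
  ∀ p q, E.Correct p → E.Correct q → ∀ τ m, (p, q, m) ∈ (E.config τ).inTransit →
    ∃ τ' ≥ τ, E.proc τ' = q ∧ E.recv τ' = some (p, m)

/-- The executions of the asynchronous crash-prone message-passing system with at most `t`
failures. -/
def Admissible (E : A.Execution input) (t : ℕ) : Prop :=
  {i | ¬ E.Correct i}.ncard ≤ t ∧ E.Reliable

/-- Process `i` has decided `v` at time `τ`. -/
def DecidedAt (E : A.Execution input) (i : Fin n) (τ : ℕ) (v : V) : Prop :=
  A.decision i ((E.config τ).state i) = some v

/-- Process `i` decides `v`. -/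
def Decides (E : A.Execution input) (i : Fin n) (v : V) : Prop :=
  ∃ τ, E.DecidedAt i τ v

/-- Decisions are never revoked or changed. -/
def Irrevocable (E : A.Execution input) : Prop :=
  ∀ i τ v, E.DecidedAt i τ v → ∀ τ' ≥ τ, E.DecidedAt i τ' v

/-- If all correct processes propose the same value `v`, no correct process decides a value
different from `v`. -/
def Validity (E : A.Execution input) : Prop :=
  ∀ v, (∀ i, E.Correct i → input i = v) → ∀ i, E.Correct i → ∀ w, E.Decides i w → w = v

/-- At most `k` different values are decided by the correct processes. -/
def Agreement (E : A.Execution input) (k : ℕ) : Prop :=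
  {v | ∃ i, E.Correct i ∧ E.Decides i v}.encard ≤ k

/-- Every correct process eventually decides. -/
def Termination (E : A.Execution input) : Prop :=
  ∀ i, E.Correct i → ∃ v, E.Decides i v

end Execution

/-- `A` solves `k`-set agreement in the asynchronous message-passing system of `n` processes, at
most `t` of which crash: all its executions have the required properties. -/
def SolvesSetAgreement (A : MPAlgorithm n V) (t k : ℕ) : Prop :=
  ∀ (input : Fin n → V) (E : A.Execution input), E.Admissible t →
    E.Irrevocable ∧ E.Validity ∧ E.Agreement k ∧ E.Termination

end MPAlgorithm

open Finset

namespace StableVector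

variable {n c : ℕ}

/-! Processes flood growing views of the input vector, and a process settles once `n - t` processes
are known to have had its view. Two such quorums meet since `n > 2t`, and the views of a common
process form a chain, so stable views are pairwise comparable (`Stable.comparable`) and there is a
least one, `S`. A process keeps its own value if at most `t` known proposals differ from it, and
else decides `d`. Differing proposals only accumulate as views grow, so a kept value is frequent in
`S` (`Sub.frequent`). If `m` values are frequent among `s ≥ n - t` known proposals, then `m(s - t) ≤
s`, so `m ≤ (n - t)/(n - 2t) < k` (`card_frequent_lt`), which leaves room for `d`. Termination holds
because views change finitely often and flooding makes the final views of correct processes equal.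
-/

/-- What a process knows about the proposals of all the processes. -/
abbrev View (n c : ℕ) := Fin n → Option (Fin c)

/-- The view of a process, the processes known to have had the same view, and the decision. -/
abbrev LocalState (n c : ℕ) := View n c × (Fin n → Bool) × Option (Fin c)

/-- The union of two views, with preference for the first one. -/
def merge (v w : View n c) : View n c := fun j => (v j).or (w j)

/-- The processes whose proposals are known in a view. -/
def known (v : View n c) : Finset (Fin n) := {j | v j ≠ none}

/-- The processes that propose `x` according to a view. -/
def proposers (v : View n c) (x : Fin c) : Finset (Fin n) := {j | v j = some x}

/-- The value decided by a process that proposes `x` and has the stable view `v`: its own one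
unless more than `t` processes are known to have proposed something else, and else the default
value `d`. -/
def choice (t : ℕ) (d : Fin c) (v : View n c) : Option (Fin c) → Fin c
  | none => d
  | some x => if #(known v) ≤ t + #(proposers v x) then x else d

/-- The processing of a received message: the views are merged; the acknowledgements are
forgotten if the view changes; and the sender is registered if it has the same view. -/
def absorb (s : LocalState n c) : Option (Fin n × View n c) → LocalState n c
  | none => s
  | some (p, w) =>
    (merge s.1 w,
      fun j => (decide (merge s.1 w = s.1) && s.2.1 j) || (decide (j = p) && decide (w = merge s.1 w)),
      s.2.2)

/-- The processes registered as having the same view. -/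
def acks (s : LocalState n c) : Finset (Fin n) := {j | s.2.1 j = true}

/-- Decide if the view is shared by `n - t` processes and there is no decision yet. -/
def settle (t : ℕ) (d : Fin c) (i : Fin n) (s : LocalState n c) : LocalState n c :=
  (s.1, s.2.1, s.2.2.or (if n ≤ t + #(acks s) then some (choice t d s.1 (s.1 i)) else none))

/-- The local transition. -/
def next (t : ℕ) (d : Fin c) (i : Fin n) (s : LocalState n c) (r : Option (Fin n × View n c)) :
    LocalState n c :=
  settle t d i (absorb s r)

/-- The stable vector algorithm: in each step, a process processes the message it receives and
sends its view to all the processes. -/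
def algorithm {V : Type*} (t : ℕ) (e : V ≃ Fin c) (d : Fin c) : MPAlgorithm n V where
  State := LocalState n c
  Msg := View n c
  init := fun i v => (fun j => if j = i then some (e v) else none, fun _ => false, none)
  step := fun i s r => (next t d i s r, (List.finRange n).map fun q => (q, (next t d i s r).1))
  decision := fun _ s => s.2.2.map e.symm
  step_computable := fun _ => (Primrec.dom_finite _).to_comp
  decision_computable := fun _ _ => by
    classical
    exact ⟨fun _ => inferInstance, (Primrec.dom_finite _).to_comp⟩

/-! ### Order on views and counting of frequent values -/

/-- The order of views by extension. -/
def Sub (v w : View n c) : Prop := ∀ j x, v j = some x → w j = some x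

theorem Sub.refl (v : View n c) : Sub v v := fun _ _ h => h

theorem Sub.trans {u v w : View n c} (h : Sub u v) (h' : Sub v w) : Sub u w :=
  fun j x hx => h' j x (h j x hx)

theorem Sub.antisymm {v w : View n c} (h : Sub v w) (h' : Sub w v) : v = w := by
  funext j
  cases hv : v j with
  | some x => exact (h j x hv).symm
  | none =>
    cases hw : w j with
    | none => rfl
    | some x => rw [h' j x hw] at hv; cases hv

theorem sub_merge (v w : View n c) : Sub v (merge v w) := fun j x h => by simp [merge, h]

theorem mem_known {v : View n c} {j : Fin n} : j ∈ known v ↔ v j ≠ none := by simp [known]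

theorem mem_proposers {v : View n c} {x : Fin c} {j : Fin n} :
    j ∈ proposers v x ↔ v j = some x := by simp [proposers]

theorem mem_acks {s : LocalState n c} {j : Fin n} : j ∈ acks s ↔ s.2.1 j = true := by
  simp [acks]

theorem proposers_subset_known (v : View n c) (x : Fin c) : proposers v x ⊆ known v := by
  intro j hj
  rw [mem_known, mem_proposers.1 hj]
  simp

theorem Sub.known_subset {v w : View n c} (h : Sub v w) : known v ⊆ known w := by
  intro j hj
  obtain ⟨x, hx⟩ := Option.ne_none_iff_exists'.1 (mem_known.1 hj)
  rw [mem_known, h j x hx]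
  simp

theorem merge_agree_or {v w : View n c} {j : Fin n} {x : Fin c} (h : merge v w j = some x) :
    v j = some x ∨ w j = some x := by
  simp only [merge, Option.or_eq_some_iff] at h
  tauto

theorem merge_eq_left_sub {v w : View n c} (h : merge v w = v)
    (hvw : ∀ j x y, v j = some x → w j = some y → x = y) : Sub w v := by
  intro j x hx
  have hj := congrFun h j
  cases hv : v j with
  | some y => rw [hvw j y x hv hx]
  | none => simp [merge, hv, hx] at hj

/-- The values that are frequent in a view are frequent in every smaller view. -/
theorem Sub.frequent {v w : View n c} (h : Sub v w) {t : ℕ} {x : Fin c}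
    (hx : #(known w) ≤ t + #(proposers w x)) : #(known v) ≤ t + #(proposers v x) := by
  -- Frequency bounds the number of known dissenters from `x`, and these persist in larger views.
  have hsub : known v \ proposers v x ⊆ known w \ proposers w x := by
    intro j hj
    rw [mem_sdiff] at hj ⊢
    refine ⟨h.known_subset hj.1, fun hw => hj.2 ?_⟩
    obtain ⟨y, hy⟩ := Option.ne_none_iff_exists'.1 (mem_known.1 hj.1)
    have := h j y hy
    rw [mem_proposers.1 hw] at this
    rw [mem_proposers, hy, this]
  have h1 := card_le_card hsub
  rw [card_sdiff_of_subset (proposers_subset_known v x),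
    card_sdiff_of_subset (proposers_subset_known w x)] at h1
  omega

/-- In a view of at least `n - t` proposals, fewer than `k` values are frequent. -/
theorem card_frequent_lt {t k : ℕ} (v : View n c) (hmaj : 2 * t < n)
    (hv : n ≤ t + #(known v)) (hk : n + 2 * t * k < t + n * k) :
    #{x | #(known v) ≤ t + #(proposers v x)} < k := by
  set T : Finset (Fin c) := {x | #(known v) ≤ t + #(proposers v x)} with hT
  have hdisj : ∑ x ∈ T, #(proposers v x) ≤ #(known v) := by
    rw [← card_biUnion]
    · exact card_le_card (biUnion_subset.2 fun x _ => proposers_subset_known v x)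
    · intro x _ y _ hxy
      rw [Function.onFun, disjoint_left]
      intro j hx hy
      rw [mem_proposers] at hx hy
      rw [hx] at hy
      exact hxy (Option.some.inj hy)
  have hsum : #T * #(known v) ≤ #T * t + #(known v) := by
    calc #T * #(known v) = ∑ _x ∈ T, #(known v) := by simp
      _ ≤ ∑ x ∈ T, (t + #(proposers v x)) :=
        sum_le_sum fun x hx => by simpa [hT] using hx
      _ = #T * t + ∑ x ∈ T, #(proposers v x) := by simp [sum_add_distrib]
      _ ≤ _ := by omega
  by_contra! hTk
  generalize #T = m at *
  generalize #(known v) = s at *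
  -- Write `n = 2t + b + 1` and `s = t + b + 1 + a`. With `k` and `m` lowered by one, `hsum` and
  -- `hk` become `h1` and `h2`, which contradict `k ≤ m`.
  obtain ⟨b, rfl⟩ := Nat.exists_eq_add_of_lt hmaj
  obtain ⟨a, rfl⟩ := Nat.exists_eq_add_of_le (show t + b + 1 ≤ s by omega)
  rcases Nat.eq_zero_or_pos k with rfl | hk1
  · omega
  obtain ⟨k, rfl⟩ := Nat.exists_eq_add_of_le' hk1
  obtain ⟨m, rfl⟩ := Nat.exists_eq_add_of_le' (le_trans hk1 hTk)
  have h1 : m * (b + 1 + a) ≤ t := by nlinarith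
  have h2 : t < k * (b + 1) := by nlinarith
  have h3 : k * (b + 1) ≤ m * (b + 1 + a) := Nat.mul_le_mul (by omega) (by omega)
  omega

/-! ### Invariants of executions -/

section Run

variable {V : Type*} {t : ℕ} {e : V ≃ Fin c} {d : Fin c} {input : Fin n → V}
  (E : (algorithm (n := n) t e d).Execution input)

/-- The local state of a process at some time of an execution. -/
def loc (i : Fin n) (τ : ℕ) : LocalState n c := (E.config τ).state i

/-- The message received at some time of an execution. -/
def rcv (τ : ℕ) : Option (Fin n × View n c) := E.recv τ

/-- The messages in transit at some time of an execution. -/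
def net (τ : ℕ) : Multiset (Fin n × Fin n × View n c) := (E.config τ).inTransit

theorem loc_zero (i : Fin n) : loc E i 0 =
    (fun j => if j = i then some (e (input i)) else none, fun _ => false, none) := by
  rw [loc, E.config_zero]; rfl

theorem loc_succ_self (τ : ℕ) :
    loc E (E.proc τ) (τ + 1) = next t d (E.proc τ) (loc E (E.proc τ) τ) (rcv E τ) := by
  obtain ⟨rest, -, h, -⟩ := E.config_succ τ
  rw [loc, h, Function.update_self]; rfl

theorem loc_succ_of_ne {i : Fin n} {τ : ℕ} (h : E.proc τ ≠ i) : loc E i (τ + 1) = loc E i τ := by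
  obtain ⟨rest, -, h', -⟩ := E.config_succ τ
  rw [loc, h', Function.update_of_ne h.symm]; rfl

theorem loc_succ (i : Fin n) (τ : ℕ) : loc E i (τ + 1) = loc E i τ ∨
    E.proc τ = i ∧ loc E i (τ + 1) = next t d i (loc E i τ) (rcv E τ) := by
  by_cases h : E.proc τ = i
  · subst h; exact Or.inr ⟨rfl, loc_succ_self E τ⟩
  · exact Or.inl (loc_succ_of_ne E h)

theorem received_mem {τ : ℕ} {p : Fin n} {w : View n c} (h : rcv E τ = some (p, w)) :
    (p, E.proc τ, w) ∈ net E τ := by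
  obtain ⟨rest, h', -, -⟩ := E.config_succ τ
  have h'' : E.recv τ = some (p, w) := h
  rw [net, h', h'']
  exact Multiset.mem_add.2 (Or.inl (Multiset.mem_singleton_self _))

theorem sent_mem (τ : ℕ) (q : Fin n) :
    (E.proc τ, q, (loc E (E.proc τ) (τ + 1)).1) ∈ net E (τ + 1) := by
  obtain ⟨rest, -, -, h⟩ := E.config_succ τ
  rw [net, h, loc_succ_self]
  refine Multiset.mem_add.2 (Or.inr (Multiset.mem_coe.2 (List.mem_map.2 ⟨(q, _), ?_, rfl⟩)))
  exact List.mem_map.2 ⟨q, List.mem_finRange q, rfl⟩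

/-- A message in transit carries a view that its sender has had. -/
theorem net_sound (τ : ℕ) : ∀ p q w, (p, q, w) ∈ net E τ →
    ∃ σ ≤ τ, (loc E p σ).1 = w := by
  induction τ with
  | zero =>
    intro p q w h
    rw [net, E.config_zero] at h
    exact absurd h (Multiset.notMem_zero _)
  | succ τ ih =>
    intro p q w h
    obtain ⟨rest, h1, -, h2⟩ := E.config_succ τ
    rw [net, h2] at h
    rcases Multiset.mem_add.1 h with h | h
    · have hmem : (p, q, w) ∈ net E τ := by
        rw [net, h1]
        exact Multiset.mem_add.2 (Or.inr h)
      obtain ⟨σ, hσ, hw⟩ := ih p q w hmem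
      exact ⟨σ, hσ.trans τ.le_succ, hw⟩
    · obtain ⟨⟨q', w'⟩, h3, h4⟩ := List.mem_map.1 (Multiset.mem_coe.1 h)
      obtain ⟨q'', -, h5⟩ := List.mem_map.1 h3
      cases h4
      cases h5
      exact ⟨τ + 1, le_rfl, by rw [loc_succ_self]; rfl⟩

theorem rcv_sound {τ : ℕ} {p : Fin n} {w : View n c} (h : rcv E τ = some (p, w)) :
    ∃ σ ≤ τ, (loc E p σ).1 = w :=
  net_sound E τ _ _ _ (received_mem E h)

theorem absorb_view_sub (s : LocalState n c) (r : Option (Fin n × View n c)) :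
    Sub s.1 (absorb s r).1 := by
  rcases r with _ | ⟨p, w⟩
  · exact Sub.refl _
  · exact sub_merge _ _

theorem view_mono (i : Fin n) {σ τ : ℕ} (h : σ ≤ τ) : Sub (loc E i σ).1 (loc E i τ).1 := by
  induction τ, h using Nat.le_induction with
  | base => exact Sub.refl _
  | succ τ _ ih =>
    refine ih.trans ?_
    rcases loc_succ E i τ with h | ⟨-, h⟩ <;> rw [h]
    · exact Sub.refl _
    · exact absorb_view_sub _ _

theorem view_comparable (i : Fin n) (σ τ : ℕ) :
    Sub (loc E i σ).1 (loc E i τ).1 ∨ Sub (loc E i τ).1 (loc E i σ).1 :=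
  (le_total σ τ).imp (view_mono E i) (view_mono E i)

theorem view_self (i : Fin n) (τ : ℕ) : (loc E i τ).1 i = some (e (input i)) :=
  view_mono E i τ.zero_le i _ (by simp [loc_zero])

/-- All the views are restrictions of the vector of proposed values. -/
theorem view_sound (τ : ℕ) : ∀ i j x, (loc E i τ).1 j = some x → x = e (input j) := by
  -- Strong induction, since a received view may be arbitrarily old.
  induction τ using Nat.strong_induction_on with
  | _ τ ih =>
    intro i j x h
    rcases τ with _ | τ
    · rw [loc_zero] at h
      by_cases hj : j = i
      · simpa [hj, eq_comm] using h
      · simp [hj] at h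
    · rcases loc_succ E i τ with h' | ⟨-, h'⟩ <;> rw [h'] at h
      · exact ih τ τ.lt_succ_self i j x h
      · rcases hr : rcv E τ with _ | ⟨p, w⟩ <;> rw [hr] at h
        · exact ih τ τ.lt_succ_self i j x h
        · rcases merge_agree_or h with h | h
          · exact ih τ τ.lt_succ_self i j x h
          · obtain ⟨σ, hσ, rfl⟩ := rcv_sound E hr
            exact ih σ (Nat.lt_succ_of_le hσ) p j x h

/-- A registered process has had the same view. -/
theorem acks_sound (τ : ℕ) : ∀ i, ∀ p ∈ acks (loc E i τ), ∃ σ, (loc E p σ).1 = (loc E i τ).1 := by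
  induction τ with
  | zero =>
    intro i p hp
    rw [mem_acks, loc_zero] at hp
    cases hp
  | succ τ ih =>
    intro i p hp
    rcases loc_succ E i τ with h' | ⟨-, h'⟩ <;> rw [h'] at hp ⊢
    · exact ih i p hp
    · rcases hr : rcv E τ with _ | ⟨q, w⟩ <;> rw [hr] at hp
      · exact ih i p hp
      · simp only [mem_acks, next, settle, absorb, Bool.or_eq_true, Bool.and_eq_true,
          decide_eq_true_eq] at hp ⊢
        rcases hp with ⟨hm, hp⟩ | ⟨rfl, hw⟩
        · rw [hm]
          exact ih i p (mem_acks.2 hp)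
        · obtain ⟨σ, -, hσ⟩ := rcv_sound E hr
          exact ⟨σ, hσ.trans hw⟩

/-! ### Stable views and safety -/

/-- A view is stable if `n - t` processes have it at some time. -/
def Stable (S : View n c) : Prop :=
  ∃ Q : Finset (Fin n), n ≤ t + #Q ∧ ∀ p ∈ Q, ∃ σ, (loc E p σ).1 = S

variable {E}

/-- Two quorums share a process, which has had both views, and its views only grow. -/
theorem Stable.comparable (hmaj : 2 * t < n) {S S' : View n c} (h : Stable E S)
    (h' : Stable E S') : Sub S S' ∨ Sub S' S := by
  obtain ⟨Q, hQ, hS⟩ := h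
  obtain ⟨Q', hQ', hS'⟩ := h'
  have hne : (Q ∩ Q').Nonempty := by
    rw [← card_pos]
    have h1 := card_union_add_card_inter Q Q'
    have h2 := card_le_univ (Q ∪ Q')
    rw [Fintype.card_fin] at h2
    omega
  obtain ⟨p, hp⟩ := hne
  rw [mem_inter] at hp
  obtain ⟨σ, rfl⟩ := hS p hp.1
  obtain ⟨σ', rfl⟩ := hS' p hp.2
  exact view_comparable E p σ σ'

/-- Every view contains its owner's proposal, so a stable view contains those of its quorum. -/
theorem Stable.card_known {S : View n c} (h : Stable E S) : n ≤ t + #(known S) := by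
  obtain ⟨Q, hQ, hS⟩ := h
  refine hQ.trans (Nat.add_le_add_left (card_le_card fun p hp => ?_) t)
  obtain ⟨σ, rfl⟩ := hS p hp
  rw [mem_known, view_self]
  simp

variable (E)

/-- Decisions are based on stable views. -/
theorem decision_sound (i : Fin n) (τ : ℕ) : ∀ x, (loc E i τ).2.2 = some x →
    ∃ S, Stable E S ∧ (∃ σ, (loc E i σ).1 = S) ∧ x = choice t d S (some (e (input i))) := by
  induction τ with
  | zero =>
    intro x hx
    rw [loc_zero] at hx
    cases hx
  | succ τ ih =>
    intro x hx
    rcases loc_succ E i τ with h' | ⟨-, h'⟩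
    · exact ih x (h' ▸ hx)
    · have hold : (absorb (loc E i τ) (rcv E τ)).2.2 = (loc E i τ).2.2 := by
        rcases rcv E τ with _ | ⟨p, w⟩ <;> rfl
      have hx' := hx
      rw [h', next, settle, hold, Option.or_eq_some_iff] at hx'
      rcases hx' with hx' | ⟨-, hx'⟩
      · exact ih x hx'
      · split_ifs at hx' with hq
        have hview : (loc E i (τ + 1)).1 = (absorb (loc E i τ) (rcv E τ)).1 := by rw [h']; rfl
        have hacks : acks (loc E i (τ + 1)) = acks (absorb (loc E i τ) (rcv E τ)) := by
          rw [h']; rfl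
        rw [← hacks] at hq
        rw [← hview, view_self] at hx'
        exact ⟨_, ⟨_, hq, acks_sound E (τ + 1) i⟩, ⟨_, rfl⟩, (Option.some.inj hx').symm⟩

theorem decision_mono (i : Fin n) {σ τ : ℕ} (h : σ ≤ τ) {x : Fin c}
    (hx : (loc E i σ).2.2 = some x) : (loc E i τ).2.2 = some x := by
  induction τ, h using Nat.le_induction with
  | base => exact hx
  | succ τ _ ih =>
    rcases loc_succ E i τ with h | ⟨-, h⟩ <;> rw [h]
    · exact ih
    · have hold : (absorb (loc E i τ) (rcv E τ)).2.2 = (loc E i τ).2.2 := by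
        rcases rcv E τ with _ | ⟨p, w⟩ <;> rfl
      simp [next, settle, hold, ih]

theorem decidedAt_iff {i : Fin n} {τ : ℕ} {v : V} :
    E.DecidedAt i τ v ↔ (loc E i τ).2.2 = some (e v) := by
  change (loc E i τ).2.2.map e.symm = some v ↔ _
  rw [Option.map_eq_some_iff]
  constructor
  · rintro ⟨x, hx, rfl⟩
    simpa using hx
  · intro h
    exact ⟨_, h, e.symm_apply_apply v⟩

theorem irrevocable : E.Irrevocable := by
  intro i τ v h τ' hτ
  rw [decidedAt_iff] at h ⊢
  exact decision_mono E i hτ h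

/-- Only faulty processes can dissent from the common value, so at most `t` do in any view and the
default is never chosen. -/
theorem validity (hE : E.Admissible t) : E.Validity := by
  classical
  rintro v hv i hi w ⟨τ, hw⟩
  obtain ⟨S, -, ⟨σ, rfl⟩, hS⟩ := decision_sound E i τ _ ((decidedAt_iff E).1 hw)
  have hcard : #(known (loc E i σ).1) ≤ t + #(proposers (loc E i σ).1 (e (input i))) := by
    have hsub : known (loc E i σ).1 ⊆
        {i | ¬ E.Correct i}.toFinite.toFinset ∪ proposers (loc E i σ).1 (e (input i)) := by
      intro j hj
      rw [mem_union, Set.Finite.mem_toFinset, mem_proposers, Set.mem_ofPred_eq]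
      refine (em (E.Correct j)).symm.imp id fun hc => ?_
      obtain ⟨x, hx⟩ := Option.ne_none_iff_exists'.1 (mem_known.1 hj)
      rw [hx, view_sound E σ i j x hx, hv j hc, hv i hi]
    refine (card_le_card hsub).trans ((card_union_le _ _).trans (Nat.add_le_add_right ?_ _))
    rw [← Set.ncard_eq_toFinset_card]
    exact hE.1
  rw [choice, if_pos hcard] at hS
  rw [e.injective hS, hv i hi]

theorem agreement {k : ℕ} (hmaj : 2 * t < n) (hk : n + 2 * t * k < t + n * k) :
    E.Agreement k := by
  by_cases hne : ∃ S, Stable E S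
  -- By comparability, a stable view with fewest known proposals is least for `Sub`.
  · have hmin : ∃ S, Stable E S ∧ ∀ S', Stable E S' → #(known S) ≤ #(known S') := by
      obtain ⟨S, hS, hmin⟩ := exists_minimalFor_of_wellFoundedLT (Stable E) (fun S => #(known S)) hne
      exact ⟨S, hS, fun S' hS' => (le_total _ _).elim id (hmin hS')⟩
    obtain ⟨S, hS, hmin⟩ := hmin
    have hleast : ∀ S', Stable E S' → Sub S S' := by
      intro S' hS'
      rcases hS.comparable hmaj hS' with h | h
      · exact h
      · have hk : known S' = known S := eq_of_subset_of_card_le h.known_subset (hmin S' hS')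
        intro j x hx
        have hj : j ∈ known S' := by rw [hk, mem_known, hx]; simp
        obtain ⟨y, hy⟩ := Option.ne_none_iff_exists'.1 (mem_known.1 hj)
        rw [hy, ← h j y hy, hx]
    set T : Finset (Fin c) := {x | #(known S) ≤ t + #(proposers S x)} with hT
    have hsub : {v | ∃ i, E.Correct i ∧ E.Decides i v} ⊆ e ⁻¹' (insert d T : Finset (Fin c)) := by
      rintro v ⟨i, -, τ, hv⟩
      obtain ⟨S', hS', -, hx⟩ := decision_sound E i τ _ ((decidedAt_iff E).1 hv)
      rw [Set.mem_preimage, mem_coe, mem_insert, hx, choice]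
      split_ifs with h
      · exact Or.inr (by simpa [hT] using (hleast S' hS').frequent h)
      · exact Or.inl rfl
    refine (Set.encard_le_encard hsub).trans ?_
    rw [Set.encard_preimage_of_bijective e.bijective, Set.encard_coe_eq_coe_finsetCard]
    have h1 := card_frequent_lt S hmaj hS.card_known hk
    have h2 := card_insert_le d T
    exact_mod_cast h2.trans h1
  · have hempty : {v | ∃ i, E.Correct i ∧ E.Decides i v} = ∅ := by
      refine Set.eq_empty_of_forall_notMem ?_
      rintro v ⟨i, -, τ, hv⟩
      obtain ⟨S, hS, -⟩ := decision_sound E i τ _ ((decidedAt_iff E).1 hv)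
      exact hne ⟨S, hS⟩
    rw [MPAlgorithm.Execution.Agreement, hempty, Set.encard_empty]
    exact zero_le

/-! ### Convergence and termination -/

/-- From some time on, the views do not change any more. -/
theorem exists_final_views : ∃ (L : Fin n → View n c) (T : ℕ), ∀ i, ∀ τ ≥ T, (loc E i τ).1 = L i := by
  -- An entry never changes once filled, and there are finitely many entries.
  have h : ∀ i j, ∃ l, ∀ᶠ τ in Filter.atTop, (loc E i τ).1 j = l := by
    intro i j
    by_cases hs : ∃ τ x, (loc E i τ).1 j = some x
    · obtain ⟨τ, x, hx⟩ := hs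
      exact ⟨some x, Filter.eventually_atTop.2 ⟨τ, fun τ' h => view_mono E i h j x hx⟩⟩
    · push Not at hs
      exact ⟨none, Filter.Eventually.of_forall fun τ => Option.eq_none_iff_forall_ne_some.2 (hs τ)⟩
  choose L hL using h
  obtain ⟨T, hT⟩ := Filter.eventually_atTop.1
    (Filter.eventually_all.2 fun i => Filter.eventually_all.2 (hL i))
  exact ⟨L, T, fun i τ hτ => funext (hT τ hτ i)⟩

/-- Acknowledgements are dropped only when the view changes. -/
theorem acks_mono {i : Fin n} {L : View n c} {T : ℕ} (hL : ∀ τ ≥ T, (loc E i τ).1 = L)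
    {σ τ : ℕ} (hσ : T ≤ σ) (hτ : σ ≤ τ) : acks (loc E i σ) ⊆ acks (loc E i τ) := by
  induction τ, hτ using Nat.le_induction with
  | base => exact Subset.refl _
  | succ τ hle ih =>
    refine ih.trans fun p hp => ?_
    rcases loc_succ E i τ with h | ⟨-, h⟩
    · rwa [h]
    · have hview : (next t d i (loc E i τ) (rcv E τ)).1 = (loc E i τ).1 := by
        rw [← h, hL _ (by omega), hL _ (by omega)]
      rw [h]
      rcases hr : rcv E τ with _ | ⟨q, w⟩ <;> rw [hr] at hview
      · exact hp
      · have hm : merge (loc E i τ).1 w = (loc E i τ).1 := hview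
        have hp' := mem_acks.1 hp
        simp [mem_acks, next, settle, absorb, hm, hp']

/-- A correct `p` steps again after `T`, and every step sends the current view to everyone. -/
theorem exists_delivery (hE : E.Reliable) {L : Fin n → View n c} {T : ℕ}
    (hL : ∀ i, ∀ τ ≥ T, (loc E i τ).1 = L i) {p q : Fin n} (hp : E.Correct p)
    (hq : E.Correct q) : ∃ τ ≥ T, E.proc τ = q ∧ rcv E τ = some (p, L p) := by
  obtain ⟨τ, hτ, rfl⟩ := hp T
  have hsent := sent_mem E τ q
  rw [hL _ _ (by omega)] at hsent
  obtain ⟨τ', hτ', h⟩ := hE _ q hp hq (τ + 1) _ hsent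
  exact ⟨τ', by omega, h⟩

theorem delivered_view {L : Fin n → View n c} {T : ℕ}
    (hL : ∀ i, ∀ τ ≥ T, (loc E i τ).1 = L i) {p q : Fin n} {τ : ℕ} (hτ : T ≤ τ)
    (hq : E.proc τ = q) (hr : rcv E τ = some (p, L p)) : merge (L q) (L p) = L q := by
  subst hq
  have h := loc_succ_self E τ
  rw [hr] at h
  have h1 := congrArg Prod.fst h
  rw [hL _ _ (by omega)] at h1
  change L (E.proc τ) = merge (loc E (E.proc τ) τ).1 (L p) at h1
  rw [hL _ _ hτ] at h1
  exact h1.symm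

/-- Receiving `L p` leaves `L q` unchanged; as `merge` favours its left argument, inclusion also
needs the two views to agree where both are defined, by `view_sound`. -/
theorem final_sub (hE : E.Reliable) {L : Fin n → View n c} {T : ℕ}
    (hL : ∀ i, ∀ τ ≥ T, (loc E i τ).1 = L i) {p q : Fin n} (hp : E.Correct p)
    (hq : E.Correct q) : Sub (L p) (L q) := by
  obtain ⟨τ, hτ, hproc, hr⟩ := exists_delivery E hE hL hp hq
  refine merge_eq_left_sub (delivered_view E hL hτ hproc hr) fun j x y hx hy => ?_
  rw [← hL _ T le_rfl] at hx hy
  rw [view_sound E T _ j x hx, view_sound E T _ j y hy]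

theorem exists_ack (hE : E.Reliable) {L : Fin n → View n c} {T : ℕ}
    (hL : ∀ i, ∀ τ ≥ T, (loc E i τ).1 = L i) {p q : Fin n} (hp : E.Correct p)
    (hq : E.Correct q) : ∃ τ ≥ T, p ∈ acks (loc E q τ) := by
  obtain ⟨τ, hτ, hproc, hr⟩ := exists_delivery E hE hL hp hq
  have hm := delivered_view E hL hτ hproc hr
  have heq := (final_sub E hE hL hp hq).antisymm (final_sub E hE hL hq hp)
  refine ⟨τ + 1, by omega, ?_⟩
  subst hproc
  rw [heq] at hm
  rw [mem_acks, loc_succ_self, hr]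
  simp [next, settle, absorb, hL _ _ hτ, hm, heq]

theorem termination (hE : E.Admissible t) : E.Termination := by
  classical
  intro i hi
  obtain ⟨L, T, hL⟩ := exists_final_views E
  have hev : ∀ p, ∀ᶠ τ in Filter.atTop, E.Correct p → p ∈ acks (loc E i τ) := by
    intro p
    by_cases hp : E.Correct p
    · obtain ⟨τ, hτ, h⟩ := exists_ack E hE.2 hL hp hi
      exact Filter.eventually_atTop.2 ⟨τ, fun τ' hle _ => acks_mono E (hL i) hτ hle h⟩
    · exact Filter.Eventually.of_forall fun _ h => absurd h hp
  obtain ⟨T', hT'⟩ := Filter.eventually_atTop.1 (Filter.eventually_all.2 hev)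
  -- The quorum is tested only during a step, so one more step of the process is needed.
  obtain ⟨τ, hτ, rfl⟩ := hi T'
  have hquorum : n ≤ t + #(acks (loc E (E.proc τ) (τ + 1))) := by
    have hsub : (univ : Finset (Fin n)) ⊆
        {i | ¬ E.Correct i}.toFinite.toFinset ∪ acks (loc E (E.proc τ) (τ + 1)) := by
      intro p _
      rw [mem_union, Set.Finite.mem_toFinset, Set.mem_ofPred_eq]
      exact (em (E.Correct p)).symm.imp id (hT' (τ + 1) (by omega) p)
    have h1 := (card_le_card hsub).trans (card_union_le _ _)
    rw [card_univ, Fintype.card_fin, ← Set.ncard_eq_toFinset_card] at h1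
    exact h1.trans (Nat.add_le_add_right hE.1 _)
  have hdec : ∃ x, (loc E (E.proc τ) (τ + 1)).2.2 = some x := by
    rw [loc_succ_self] at hquorum ⊢
    change n ≤ t + #(acks (absorb (loc E (E.proc τ) τ) (rcv E τ))) at hquorum
    rw [next, settle, if_pos hquorum]
    cases (absorb (loc E (E.proc τ) τ) (rcv E τ)).2.2 <;> simp
  obtain ⟨x, hx⟩ := hdec
  exact ⟨e.symm x, τ + 1, (decidedAt_iff E).2 (by simpa using hx)⟩

end Run

end StableVector

theorem mainTheorem7 (n t k : ℕ) (hmaj : 2 * t < n)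
    (hk : ((n : ℝ) - (t : ℝ)) / ((n : ℝ) - 2 * (t : ℝ)) < (k : ℝ))
    (V : Type*) [Finite V] (hV : k + 1 ≤ Nat.card V) :
    ∃ A : MPAlgorithm n V, A.SolvesSetAgreement t k := by
  have hk' : n + 2 * t * k < t + n * k := by
    have hpos : (0 : ℝ) < (n : ℝ) - 2 * t := sub_pos.2 (by exact_mod_cast hmaj)
    rw [div_lt_iff₀ hpos] at hk
    have : (n : ℝ) + 2 * t * k < t + n * k := by linarith
    exact_mod_cast this
  -- Any default value would do; `hV` serves only to make `V` nonempty.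
  refine ⟨StableVector.algorithm t (Finite.equivFin V) ⟨0, by omega⟩, fun input E hE => ?_⟩
  exact ⟨StableVector.irrevocable E, StableVector.validity E hE,
    StableVector.agreement E hmaj hk', StableVector.termination E hE⟩
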